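/- Let $V$ be a vertex algebra over $\mathbb{C}$ with vacuum $|0\rangle$ and fields $a(z)=\sum_{n\in\mathbb{Z}}a_{(n)}z^{-n-1}$, and let $R_V=V/C_2(V)$, where $C_2(V)$ is the linear span of all $a_{(-2)}b$ ($a,b\in V$), be Zhu's $C_2$-algebra, a commutative Poisson algebra with $\bar a\cdot\bar b=\overline{a_{(-1)}b}$ and $\{\bar a,\bar b\}=\overline{a_{(0)}b}$. Suppose that: (i) $V$ is conical: $R_V$ is a finitely generated algebra; $V$ has a conformal vector $\omega$ (the operators $L_n=\omega_{(n+1)}$ satisfy the Virasoro relations for some central charge, $L_{-1}a=a_{(-2)}|0\rangle$ for all $a\in V$, and $L_0$ is diagonalizable); and, with $V_\Delta=\{v\in V\mid L_0v=\Delta v\}$, one has $V=\bigoplus_{\Delta\in\frac1m\mathbb{Z}_{\ge 0}}V_\Delta$ for some integer $m\ge 1$, $\dim V_\Delta<\infty$ for all $\Delta$, and $V_0\cong\mathbb{C}$ (that is, $\dim V_0=1$); (ii) $V$ is quasi-lisse: $R_V$ is finitely generated and the associated variety $X_V=\operatorname{Specm}(R_V)$ has only finitely many symplectic leaves. Here $X_V$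 is partitioned into the smooth strata $X_k=Z_k\setminus Z_{k+1}$, where $Z_0=X_V$ and $Z_{k+1}$ is the singular locus of the reduced variety $Z_k$, and the symplectic leaf of a point $x\in X_k$ is the set of points of $X_k$ that can be reached from $x$ by piecewise Hamiltonian curves in $X_k$. Then the image $[\omega]$ of the conformal vector $\omega$ in $R_V$ is nilpotent. -/

import Mathlib

/-!
# Vertex algebras, Zhu's `C₂`-algebra and symplectic leaves
-/

noncomputable section

/-! ## Vertex algebras -/

/-- A vertex algebra over `ℂ`: a state-field correspondence `a ↦ a(z) = ∑ a₍ₙ₎ z^(-n-1)` with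
`a(z)b ∈ V((z))` and a vacuum vector `𝟙`, satisfying the vacuum and creation axioms and the
Borcherds identity. The translation operator is `T a = a₍₋₂₎𝟙`. -/
class VertexAlgebra (V : Type*) [AddCommGroup V] [Module ℂ V] where
  /-- The state-field correspondence. -/
  Y : V →ₗ[ℂ] VertexOperator ℂ V
  /-- The vacuum vector. -/
  vac : V
  vac_ncoeff : ∀ (n : ℤ) (a : V), (Y vac).ncoeff n a = if n = -1 then a else 0
  ncoeff_vac : ∀ a : V, (Y a).ncoeff (-1) vac = a
  ncoeff_vac_of_nonneg : ∀ (a : V) (n : ℤ), 0 ≤ n → (Y a).ncoeff n vac = 0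
  /-- `∑ᵢ C(p,i) (a₍ᵣ₊ᵢ₎b)₍ₚ₊q₋ᵢ₎c
      = ∑ᵢ (-1)ⁱ C(r,i) (a₍ₚ₊ᵣ₋ᵢ₎b₍q₊ᵢ₎c - (-1)ʳ b₍q₊ᵣ₋ᵢ₎a₍ₚ₊ᵢ₎c)`;
  both sums have only finitely many nonzero terms. -/
  borcherds : ∀ (p q r : ℤ) (a b c : V),
    ∑ᶠ i : ℕ, Ring.choose p i • (Y ((Y a).ncoeff (r + i) b)).ncoeff (p + q - i) c =
    ∑ᶠ i : ℕ, ((-1) ^ i * Ring.choose r i) •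
      ((Y a).ncoeff (p + r - i) ((Y b).ncoeff (q + i) c) -
        (r.negOnePow : ℤ) • (Y b).ncoeff (q + r - i) ((Y a).ncoeff (p + i) c))

namespace VertexAlgebra

variable {V : Type*} [AddCommGroup V] [Module ℂ V] [VertexAlgebra V]

/-- The `n`-th product `a₍ₙ₎b`, bilinear in `a` and `b`. -/
def nprod (n : ℤ) : V →ₗ[ℂ] V →ₗ[ℂ] V :=
  LinearMap.proj n ∘ₗ VertexOperator.ncoeff ∘ₗ Y

lemma nprod_apply (n : ℤ) (a b : V) : nprod n a b = (Y a).ncoeff n b := rfl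

lemma vac_nprod (n : ℤ) (a : V) : nprod n (vac : V) a = if n = -1 then a else 0 :=
  vac_ncoeff n a

lemma nprod_vac (a : V) : nprod (-1) a (vac : V) = a := ncoeff_vac a

lemma nprod_vac_of_nonneg (a : V) (n : ℤ) (hn : 0 ≤ n) : nprod n a (vac : V) = 0 :=
  ncoeff_vac_of_nonneg a n hn

lemma nprod_borcherds (p q r : ℤ) (a b c : V) :
    ∑ᶠ i : ℕ, Ring.choose p i • nprod (p + q - i) (nprod (r + i) a b) c =
    ∑ᶠ i : ℕ, ((-1) ^ i * Ring.choose r i) •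
      (nprod (p + r - i) a (nprod (q + i) b c) -
        (r.negOnePow : ℤ) • nprod (q + r - i) b (nprod (p + i) a c)) :=
  borcherds p q r a b c

lemma exists_nprod_eq_zero (a b : V) : ∃ N : ℤ, ∀ n, N ≤ n → nprod n a b = 0 := by
  refine ⟨-((HahnModule.of ℂ).symm (Y a b)).order, fun n hn => ?_⟩
  rw [nprod_apply]
  exact VertexOperator.ncoeff_eq_zero_of_lt_order _ _ _ (by omega)

variable (V) in
/-- `C₂(V)`, the linear span of all `a₍₋₂₎b`. -/
def C2 : Submodule ℂ V := Submodule.span ℂ {x | ∃ a b : V, x = nprod (-2) a b}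

/-! ### `C₂(V)` is compatible with the products `(-1)` and `(0)` -/

lemma commutator (p q : ℤ) (a b c : V) :
    nprod p a (nprod q b c) - nprod q b (nprod p a c) =
      ∑ᶠ i : ℕ, Ring.choose p i • nprod (p + q - i) (nprod i a b) c := by
  have h := nprod_borcherds p q 0 a b c
  rw [finsum_eq_single (a := 0) (f := fun i : ℕ => ((-1) ^ i * Ring.choose (0 : ℤ) i) • _)] at h
  · simpa using h.symm
  · intro i hi
    obtain ⟨j, rfl⟩ := Nat.exists_eq_succ_of_ne_zero hi
    simp [Ring.choose_zero_succ]

lemma iterate (q r : ℤ) (a b c : V) :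
    nprod q (nprod r a b) c = ∑ᶠ i : ℕ, ((-1) ^ i * Ring.choose r i) •
      (nprod (r - i) a (nprod (q + i) b c) -
        (r.negOnePow : ℤ) • nprod (q + r - i) b (nprod i a c)) := by
  have h := nprod_borcherds 0 q r a b c
  rw [finsum_eq_single (a := 0)] at h
  · simpa using h
  · intro i hi
    obtain ⟨j, rfl⟩ := Nat.exists_eq_succ_of_ne_zero hi
    simp [Ring.choose_zero_succ]

lemma nprod_zero_comm (q : ℤ) (a b c : V) :
    nprod 0 a (nprod q b c) = nprod q (nprod 0 a b) c + nprod q b (nprod 0 a c) := by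
  have h := commutator 0 q a b c
  rw [finsum_eq_single (a := 0)] at h
  · simp at h
    rw [← h]; abel
  · intro i hi
    obtain ⟨j, rfl⟩ := Nat.exists_eq_succ_of_ne_zero hi
    simp [Ring.choose_zero_succ]

lemma choose_neg_two (i : ℕ) : (-1) ^ i * Ring.choose (-2 : ℤ) i = i + 1 := by
  rw [Ring.choose_neg]
  have : (2 + (i : ℤ) - 1) = ((i + 1 : ℕ) : ℤ) := by push_cast; ring
  rw [this, Ring.choose_natCast, Int.negOnePow_def]
  rw [Units.smul_def, smul_eq_mul, ← mul_assoc]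
  simp [← mul_pow]

lemma translation (n : ℤ) (a c : V) :
    nprod n (nprod (-2) a vac) c = -n • nprod (n - 1) a c := by
  rw [iterate]
  rcases lt_trichotomy n 0 with hn | rfl | hn
  · obtain ⟨k, hk⟩ : ∃ k : ℕ, n = -1 - k := ⟨(-1 - n).toNat, by omega⟩
    rw [finsum_eq_single (a := k), choose_neg_two]
    · rw [vac_nprod, vac_nprod, if_pos (by omega), if_neg (by omega), smul_zero, sub_zero]
      rw [show (k : ℤ) + 1 = -n by omega, show (-2 - k : ℤ) = n - 1 by omega]
    · intro i hi
      rw [vac_nprod, vac_nprod, if_neg (by omega), if_neg (by omega)]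
      simp
  · rw [finsum_eq_zero_of_forall_eq_zero]
    · simp
    · intro i
      rw [vac_nprod, vac_nprod, if_neg (by omega), if_neg (by omega)]
      simp
  · obtain ⟨k, hk⟩ : ∃ k : ℕ, n = 1 + k := ⟨(n - 1).toNat, by omega⟩
    rw [finsum_eq_single (a := k), choose_neg_two]
    · rw [vac_nprod, vac_nprod, if_neg (by omega), if_pos (by omega)]
      have : Int.negOnePow (-2) = 1 := Int.negOnePow_even _ (by decide)
      rw [this, map_zero, zero_sub, Units.val_one, one_smul, smul_neg, neg_smul]
      rw [show (k : ℤ) + 1 = n by omega, show (k : ℤ) = n - 1 by omega]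
    · intro i hi
      rw [vac_nprod, vac_nprod, if_neg (by omega), if_neg (by omega)]
      simp

lemma nprod_neg_mem_C2 (k : ℕ) (a b : V) : nprod (-2 - k) a b ∈ C2 V := by
  induction k generalizing a with
  | zero => exact Submodule.subset_span ⟨a, b, by simp⟩
  | succ k ih =>
    have h := ih (nprod (-2) a vac)
    rw [translation, ← Int.cast_smul_eq_zsmul ℂ] at h
    have h2 := (C2 V).smul_mem (((-(-2 - k : ℤ) : ℤ) : ℂ)⁻¹) h
    rw [inv_smul_smul₀] at h2
    · rwa [show (-2 - k - 1 : ℤ) = -2 - (k + 1 : ℕ) by push_cast; ring] at h2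
    · exact_mod_cast (by omega : -(-2 - (k : ℤ)) ≠ 0)

lemma nprod_mem_C2 {n : ℤ} (hn : n ≤ -2) (a b : V) : nprod n a b ∈ C2 V := by
  have := nprod_neg_mem_C2 (-2 - n).toNat a b
  rwa [show -2 - ((-2 - n).toNat : ℤ) = n by omega] at this

lemma finsum_mem_C2 {f : ℕ → V} (hf : ∀ i, f i ∈ C2 V) : ∑ᶠ i, f i ∈ C2 V :=
  finsum_induction (· ∈ C2 V) (C2 V).zero_mem (fun _ _ => (C2 V).add_mem) hf

lemma finsum_sub_mem_C2 {f : ℕ → V} (hfin : f.HasFiniteSupport) (hf : ∀ i, i ≠ 0 → f i ∈ C2 V) :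
    ∑ᶠ i, f i - f 0 ∈ C2 V := by
  classical
  have h0 : (Pi.single 0 (f 0) : ℕ → V).HasFiniteSupport :=
    (Set.finite_singleton 0).subset (by
      intro i hi
      by_contra h
      exact hi (Pi.single_eq_of_ne h _))
  have : f 0 = ∑ᶠ i, (Pi.single 0 (f 0) : ℕ → V) i := by
    rw [finsum_eq_single (a := 0)]
    · simp
    · intro i hi
      simp [hi]
  rw [this, ← finsum_sub_distrib hfin h0]
  refine finsum_mem_C2 fun i => ?_
  by_cases hi : i = 0
  · subst hi; simp
  · simpa [hi] using hf i hi

lemma hasFiniteSupport_of_bound {W : Type*} [AddCommGroup W] {f : ℕ → W} (N : ℤ) (hf : ∀ i : ℕ, N ≤ i → f i = 0) :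
    f.HasFiniteSupport := by
  refine (Set.finite_lt_nat N.toNat).subset fun i hi => ?_
  by_contra h
  exact hi (hf i (by simp at h; omega))

lemma C2_induction {P : V → Prop} (h : ∀ a b, P (nprod (-2) a b)) (h0 : P 0)
    (hadd : ∀ x y, P x → P y → P (x + y)) (hsmul : ∀ (c : ℂ) x, P x → P (c • x))
    {x : V} (hx : x ∈ C2 V) : P x := by
  refine Submodule.span_induction (p := fun x _ => P x) ?_ h0 (fun x y _ _ => hadd x y)
    (fun c x _ => hsmul c x) hx
  rintro x ⟨a, b, rfl⟩
  exact h a b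

lemma nprod_right_mem_C2 {n : ℤ} (hn : n = -1 ∨ n = 0) (a : V) {x : V} (hx : x ∈ C2 V) :
    nprod n a x ∈ C2 V := by
  refine C2_induction (P := fun x => nprod n a x ∈ C2 V) (fun b c => ?_) (by simp)
    (fun x y hx hy => by rw [map_add]; exact add_mem hx hy)
    (fun k x hx => by rw [map_smul]; exact (C2 V).smul_mem _ hx) hx
  have h := commutator n (-2) a b c
  rw [sub_eq_iff_eq_add] at h
  rw [h]
  refine add_mem (finsum_mem_C2 fun i => ?_) (nprod_mem_C2 le_rfl _ _)
  exact zsmul_mem (nprod_mem_C2 (by omega) _ _) _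

lemma nprod_left_mem_C2 {n : ℤ} (hn : n = -1 ∨ n = 0) (b : V) {x : V} (hx : x ∈ C2 V) :
    nprod n x b ∈ C2 V := by
  refine C2_induction (P := fun x => nprod n x b ∈ C2 V) (fun a c => ?_) (by simp)
    (fun x y hx hy => by rw [map_add]; exact add_mem hx hy)
    (fun k x hx => by rw [map_smul]; exact (C2 V).smul_mem _ hx) hx
  rw [iterate]
  refine finsum_mem_C2 fun i => zsmul_mem (sub_mem ?_ (zsmul_mem ?_ _)) _
  · exact nprod_mem_C2 (by omega) _ _
  · exact nprod_mem_C2 (by omega) _ _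

lemma mul_comm_mem_C2 (a b : V) : nprod (-1) a b - nprod (-1) b a ∈ C2 V := by
  have h := commutator (-1) (-1) a b vac
  rw [nprod_vac, nprod_vac] at h
  rw [h]
  exact finsum_mem_C2 fun i => zsmul_mem (nprod_mem_C2 (by omega) _ _) _

lemma mul_assoc_mem_C2 (a b c : V) :
    nprod (-1) (nprod (-1) a b) c - nprod (-1) a (nprod (-1) b c) ∈ C2 V := by
  set f : ℕ → V := fun i => ((-1) ^ i * Ring.choose (-1 : ℤ) i) •
      (nprod (-1 - i) a (nprod (-1 + i) b c) -
        ((-1 : ℤ).negOnePow : ℤ) • nprod (-1 + -1 - i) b (nprod i a c)) with hf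
  have hfin : f.HasFiniteSupport := by
    obtain ⟨N, hN⟩ := exists_nprod_eq_zero b c
    obtain ⟨M, hM⟩ := exists_nprod_eq_zero a c
    refine hasFiniteSupport_of_bound (max (N + 1) M) fun i hi => ?_
    simp only [hf]
    rw [hN _ (by omega), hM _ (by omega)]
    simp
  have h := finsum_sub_mem_C2 hfin fun i hi => by
    refine zsmul_mem (sub_mem ?_ (zsmul_mem ?_ _)) _
    · exact nprod_mem_C2 (by omega) _ _
    · exact nprod_mem_C2 (by omega) _ _
  rw [iterate]
  have h0 : nprod (-1) a (nprod (-1) b c) - f 0 ∈ C2 V := by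
    have : nprod (-1) a (nprod (-1) b c) - f 0 =
        ((-1 : ℤ).negOnePow : ℤ) • nprod (-1 + -1) b (nprod 0 a c) := by
      simp [hf]
    rw [this]
    exact zsmul_mem (nprod_mem_C2 (by omega) _ _) _
  have := sub_mem h h0
  rwa [sub_sub_sub_cancel_right] at this

lemma bracket_skew_mem_C2 (a b : V) : nprod 0 a b + nprod 0 b a ∈ C2 V := by
  have h := commutator (-1) 0 a b vac
  rw [nprod_vac, nprod_vac_of_nonneg _ _ le_rfl, map_zero, zero_sub] at h
  set f : ℕ → V := fun i => Ring.choose (-1 : ℤ) i • nprod (-1 + 0 - i) (nprod i a b) vac with hf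
  have hfin : f.HasFiniteSupport := by
    obtain ⟨N, hN⟩ := exists_nprod_eq_zero a b
    refine hasFiniteSupport_of_bound N fun i hi => ?_
    simp only [hf]
    rw [hN _ hi]
    simp
  have h1 := finsum_sub_mem_C2 hfin fun i hi => zsmul_mem (nprod_mem_C2 (by omega) _ _) _
  have h0 : f 0 = nprod 0 a b := by simp [hf, nprod_vac]
  rw [← h, h0, ← neg_mem_iff] at h1
  convert h1 using 1
  abel

/-! ### Zhu's `C₂`-algebra -/

variable (V) in
/-- Zhu's `C₂`-algebra `R_V = V / C₂(V)`. -/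
def ZhuC2 : Type _ := V ⧸ C2 V

namespace ZhuC2

instance : AddCommGroup (ZhuC2 V) := inferInstanceAs (AddCommGroup (V ⧸ C2 V))
instance : Module ℂ (ZhuC2 V) := inferInstanceAs (Module ℂ (V ⧸ C2 V))

/-- The image `ā` of `a` in `R_V`. -/
def mk : V →ₗ[ℂ] ZhuC2 V := (C2 V).mkQ

lemma mk_surjective : Function.Surjective (mk : V →ₗ[ℂ] ZhuC2 V) := (C2 V).mkQ_surjective

lemma mk_eq_zero {a : V} : mk a = 0 ↔ a ∈ C2 V := Submodule.Quotient.mk_eq_zero _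

lemma mk_eq_mk {a b : V} : mk a = mk b ↔ a - b ∈ C2 V := by
  rw [← sub_eq_zero, ← map_sub, mk_eq_zero]

/-- The operation on `R_V` induced by the `n`-th product of `V`, for `n = -1` and `n = 0`. -/
def lift₂ (n : ℤ) (hn : n = -1 ∨ n = 0) : ZhuC2 V →ₗ[ℂ] ZhuC2 V →ₗ[ℂ] ZhuC2 V :=
  (C2 V).liftQ
    { toFun a := (C2 V).liftQ (mk ∘ₗ nprod n a) fun x hx => by
        rw [LinearMap.mem_ker, LinearMap.comp_apply, mk_eq_zero]
        exact nprod_right_mem_C2 hn a hx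
      map_add' a b := by
        apply Submodule.linearMap_qext
        ext x
        change mk (nprod n (a + b) x) = mk (nprod n a x) + mk (nprod n b x)
        simp
      map_smul' c a := by
        apply Submodule.linearMap_qext
        ext x
        change mk (nprod n (c • a) x) = c • mk (nprod n a x)
        simp }
    fun x hx => by
      rw [LinearMap.mem_ker]
      apply Submodule.linearMap_qext
      ext b
      exact mk_eq_zero.2 (nprod_left_mem_C2 hn b hx)

lemma lift₂_mk (n : ℤ) (hn : n = -1 ∨ n = 0) (a b : V) :
    lift₂ n hn (mk a) (mk b) = mk (nprod n a b) := rfl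

/-- The product `ā · b̄ = a₍₋₁₎b`. -/
instance : Mul (ZhuC2 V) := ⟨fun x y => lift₂ (-1) (Or.inl rfl) x y⟩

instance : One (ZhuC2 V) := ⟨mk vac⟩

lemma mul_def (x y : ZhuC2 V) : x * y = lift₂ (-1) (Or.inl rfl) x y := rfl

lemma mk_mul_mk (a b : V) : mk a * mk b = mk (nprod (-1) a b) := rfl

lemma one_def : (1 : ZhuC2 V) = mk vac := rfl

protected lemma mul_comm' (x y : ZhuC2 V) : x * y = y * x := by
  obtain ⟨a, rfl⟩ := mk_surjective x
  obtain ⟨b, rfl⟩ := mk_surjective y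
  rw [mk_mul_mk, mk_mul_mk, mk_eq_mk]
  exact mul_comm_mem_C2 a b

protected lemma one_mul' (x : ZhuC2 V) : 1 * x = x := by
  obtain ⟨a, rfl⟩ := mk_surjective x
  rw [one_def, mk_mul_mk, vac_nprod, if_pos rfl]

instance : CommRing (ZhuC2 V) where
  __ := (inferInstance : AddCommGroup (ZhuC2 V))
  mul := (· * ·)
  one := 1
  left_distrib x y z := by simp only [mul_def, map_add]
  right_distrib x y z := by simp only [mul_def, map_add, LinearMap.add_apply]
  zero_mul x := by simp only [mul_def, map_zero, LinearMap.zero_apply]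
  mul_zero x := by simp only [mul_def, map_zero]
  mul_assoc x y z := by
    obtain ⟨a, rfl⟩ := mk_surjective x
    obtain ⟨b, rfl⟩ := mk_surjective y
    obtain ⟨c, rfl⟩ := mk_surjective z
    simp only [mk_mul_mk, mk_eq_mk]
    exact mul_assoc_mem_C2 a b c
  one_mul := ZhuC2.one_mul'
  mul_one x := by rw [ZhuC2.mul_comm', ZhuC2.one_mul']
  mul_comm := ZhuC2.mul_comm'

instance : Algebra ℂ (ZhuC2 V) :=
  Algebra.ofModule
    (fun r x y => by simp only [mul_def, map_smul, LinearMap.smul_apply])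
    (fun r x y => by simp only [mul_def, map_smul])

end ZhuC2

end VertexAlgebra

/-! ## Poisson algebras and symplectic leaves -/

/-- A Poisson algebra structure on a commutative `ℂ`-algebra. -/
class PoissonAlgebra (R : Type*) [CommRing R] [Algebra ℂ R] where
  /-- The Poisson bracket. -/
  bracket : R →ₗ[ℂ] R →ₗ[ℂ] R
  bracket_self : ∀ f, bracket f f = 0
  jacobi : ∀ f g h, bracket f (bracket g h) = bracket (bracket f g) h + bracket g (bracket f h)
  leibniz : ∀ f g h, bracket f (g * h) = bracket f g * h + g * bracket f h

/-- The Poisson bracket `{ā, b̄} = a₍₀₎b` on Zhu's `C₂`-algebra. -/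
instance VertexAlgebra.ZhuC2.instPoissonAlgebra {V : Type*} [AddCommGroup V] [Module ℂ V]
    [VertexAlgebra V] : PoissonAlgebra (VertexAlgebra.ZhuC2 V) where
  bracket := lift₂ 0 (Or.inr rfl)
  bracket_self x := by
    obtain ⟨a, rfl⟩ := mk_surjective x
    have h := mk_eq_zero.2 (bracket_skew_mem_C2 a a)
    rw [map_add, ← two_smul ℂ, smul_eq_zero] at h
    rw [lift₂_mk]
    exact h.resolve_left two_ne_zero
  jacobi x y z := by
    obtain ⟨a, rfl⟩ := mk_surjective x
    obtain ⟨b, rfl⟩ := mk_surjective y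
    obtain ⟨c, rfl⟩ := mk_surjective z
    simp only [lift₂_mk, ← map_add]
    rw [nprod_zero_comm]
  leibniz x y z := by
    obtain ⟨a, rfl⟩ := mk_surjective x
    obtain ⟨b, rfl⟩ := mk_surjective y
    obtain ⟨c, rfl⟩ := mk_surjective z
    simp only [lift₂_mk, mk_mul_mk, ← map_add]
    rw [nprod_zero_comm]

/-- The closed points of `Spec R`, for a finitely generated `ℂ`-algebra `R`, as `ℂ`-valued points:
`x : R →ₐ[ℂ] ℂ` corresponds to the maximal ideal `ker x`, and `x f` is the value of `f` at `x`. -/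
abbrev Specm (R : Type*) [CommRing R] [Algebra ℂ R] : Type _ := R →ₐ[ℂ] ℂ

namespace Specm

/-- By the Nullstellensatz, `Specm R` is the set of maximal ideals of `R`. -/
lemma ker_bijective (R : Type*) [CommRing R] [Algebra ℂ R] [Algebra.FiniteType ℂ R] :
    Function.Bijective (fun x : Specm R =>
      (⟨RingHom.ker x, RingHom.ker_isMaximal_of_surjective x
        fun c => ⟨algebraMap ℂ R c, x.commutes c⟩⟩ : MaximalSpectrum R)) := by
  constructor
  · intro x y h
    have h' : RingHom.ker x = RingHom.ker y := congrArg MaximalSpectrum.asIdeal h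
    ext f
    have : f - algebraMap ℂ R (x f) ∈ RingHom.ker x := by simp [RingHom.mem_ker]
    rw [h', RingHom.mem_ker, map_sub, AlgHom.commutes, sub_eq_zero] at this
    exact this.symm
  · rintro ⟨m, hm⟩
    let _ : Field (R ⧸ m) := Ideal.Quotient.field m
    have : Algebra.FiniteType ℂ (R ⧸ m) := inferInstance
    have : Module.Finite ℂ (R ⧸ m) := finite_of_finite_type_of_isJacobsonRing ℂ (R ⧸ m)
    have hb : Function.Bijective (algebraMap ℂ (R ⧸ m)) :=
      IsAlgClosed.algebraMap_bijective_of_isIntegral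
    let e : ℂ ≃ₐ[ℂ] (R ⧸ m) := AlgEquiv.ofBijective (Algebra.ofId ℂ (R ⧸ m)) hb
    refine ⟨(e.symm : (R ⧸ m) →ₐ[ℂ] ℂ).comp (Ideal.Quotient.mkₐ ℂ m), ?_⟩
    ext f
    simp [RingHom.mem_ker, Ideal.Quotient.eq_zero_iff_mem]

variable {R : Type*} [CommRing R] [Algebra ℂ R]

/-- The ideal of the functions vanishing on a set of closed points. -/
def vanishingIdeal (Z : Set (Specm R)) : Ideal R := ⨅ x ∈ Z, RingHom.ker x

instance (x : Specm R) : (RingHom.ker x).IsPrime := RingHom.ker_isPrime _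

/-- The singular locus of a closed subset `Z`, viewed as a reduced variety with coordinate ring
`R / I(Z)`: the points whose local ring is not regular. -/
def singularLocus (Z : Set (Specm R)) : Set (Specm R) :=
  {x | ∃ y : Specm (R ⧸ vanishingIdeal Z),
    y.comp (Ideal.Quotient.mkₐ ℂ (vanishingIdeal Z)) = x ∧
    ¬ IsRegularLocalRing (Localization.AtPrime (RingHom.ker y))}

variable (R) in
/-- The chain `Z₀ = Specm R`, `Zₖ₊₁ = Sing(Zₖ)`. -/
def singularChain : ℕ → Set (Specm R)
  | 0 => Set.univ
  | k + 1 => singularLocus (singularChain k)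

variable (R) in
/-- The smooth strata `Xₖ = Zₖ \ Sing(Zₖ)`; if `R` is finitely generated they form a finite
partition of `Specm R`. -/
def stratum (k : ℕ) : Set (Specm R) := singularChain R k \ singularChain R (k + 1)

variable [PoissonAlgebra R]

/-- `γ`, restricted to `[0,1]`, is an integral curve of the Hamiltonian vector field
`ξ_f = {f, ·}`: along `γ` every function `g` satisfies `d/dt g(γ(t)) = {f, g}(γ(t))`. -/
def IsHamiltonianCurve (f : R) (γ : ℝ → Specm R) : Prop :=
  ∀ t ∈ Set.Icc (0 : ℝ) 1, ∀ g : R,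
    HasDerivWithinAt (fun s => γ s g) (γ t (PoissonAlgebra.bracket f g)) (Set.Icc 0 1) t

/-- Two points of the same stratum are joined by the flow of a Hamiltonian vector field
inside that stratum. -/
def HamiltonianJoined (x y : Specm R) : Prop :=
  ∃ (k : ℕ) (f : R) (γ : ℝ → Specm R), IsHamiltonianCurve f γ ∧
    (∀ t ∈ Set.Icc (0 : ℝ) 1, γ t ∈ stratum R k) ∧ γ 0 = x ∧ γ 1 = y

variable (R) in
/-- Two points lie on the same symplectic leaf if and only if they are joined by a piecewise
Hamiltonian curve inside a stratum. -/
def leafSetoid : Setoid (Specm R) := Relation.EqvGen.setoid HamiltonianJoined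

variable (R) in
/-- The set of symplectic leaves of `Specm R`. -/
abbrev SymplecticLeaves : Type _ := Quotient (leafSetoid R)

end Specm

/-! ## Conical quasi-lisse vertex algebras -/

namespace VertexAlgebra

variable {V : Type*} [AddCommGroup V] [Module ℂ V] [VertexAlgebra V]

variable (V) in
/-- `V` is finitely strongly generated: `R_V` is a finitely generated algebra. -/
def IsFinitelyStronglyGenerated : Prop := Algebra.FiniteType ℂ (ZhuC2 V)

variable (V) in
/-- `V` is quasi-lisse: it is finitely strongly generated and its associated variety
`X_V = Specm R_V` has only finitely many symplectic leaves. -/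
def IsQuasiLisse : Prop :=
  IsFinitelyStronglyGenerated V ∧ Finite (Specm.SymplecticLeaves (ZhuC2 V))

/-- The operator `Lₙ = ω₍ₙ₊₁₎`. -/
def virasoro (ω : V) (n : ℤ) : Module.End ℂ V := nprod (n + 1) ω

/-- `ω` is a conformal vector: the `Lₙ` satisfy the Virasoro relations for some central charge,
`L₋₁` is the translation operator, and `L₀` is diagonalizable. -/
structure IsConformalVector (ω : V) : Prop where
  virasoro_relations : ∃ c : ℂ, ∀ m n : ℤ,
    virasoro ω m * virasoro ω n - virasoro ω n * virasoro ω m =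
      ((m - n : ℤ) : ℂ) • virasoro ω (m + n) +
        (if m + n = 0 then ((m ^ 3 - m : ℤ) : ℂ) / 12 * c else 0) • (1 : Module.End ℂ V)
  virasoro_neg_one : ∀ a : V, virasoro ω (-1) a = nprod (-2) a vac
  diagonalizable : ⨆ μ : ℂ, (virasoro ω 0).eigenspace μ = ⊤

/-- The weight space `V_Δ = {v | L₀ v = Δ v}`. -/
def weightSpace (ω : V) (Δ : ℂ) : Submodule ℂ V := (virasoro ω 0).eigenspace Δ

/-- `V` with conformal vector `ω` is conical: it is finitely strongly generated,
`V = ⨁_{Δ ∈ (1/m)ℤ≥0} V_Δ` for some `m ≥ 1`, every `V_Δ` is finite-dimensional, and `V₀ = ℂ`. -/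
structure IsConical (ω : V) : Prop where
  finitelyStronglyGenerated : IsFinitelyStronglyGenerated V
  conformal : IsConformalVector ω
  grading : ∃ m : ℕ, 0 < m ∧
    DirectSum.IsInternal (fun k : ℕ => weightSpace ω ((k : ℂ) / (m : ℂ)))
  finite_dimensional : ∀ Δ : ℂ, FiniteDimensional ℂ (weightSpace ω Δ)
  weight_zero : Module.finrank ℂ (weightSpace ω 0) = 1

end VertexAlgebra

end

/-! Two properties of `[ω]` in `R_V` conflict unless it is nilpotent. Geometrically, `ω₍₀₎ = L₋₁` is
translation, whose image lies in `C₂(V)`, so `[ω]` is a Casimir element. It is therefore constant on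
each symplectic leaf and takes finitely many values on `X_V`. By the Nullstellensatz a polynomial
vanishing at these values sends `[ω]` to a nilpotent element, so `[ω]` is integral over `ℂ`.

Algebraically, `L₀` descends to a derivation of `R_V` for which `[ω]` has weight 2. Hence `[ω]ⁿ` has
weight `2n`, and if no power vanishes, all powers are linearly independent over `ℂ`, which excludes
a monic relation. -/

namespace VertexAlgebra

variable {V : Type*} [AddCommGroup V] [Module ℂ V] [VertexAlgebra V]

/-! ### The weight derivation on `R_V` and the Casimir property of `[ω]` -/

namespace IsConformalVector

variable {ω : V}

lemma nprod_zero (h : IsConformalVector ω) (a : V) : nprod 0 ω a = nprod (-2) a vac :=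
  h.virasoro_neg_one a

/-- `L₀` acts on `n`-th products by `L₀(a₍ₙ₎b) = (L₀a)₍ₙ₎b + a₍ₙ₎(L₀b) - (n + 1) a₍ₙ₎b`. -/
lemma nprod_one_nprod (h : IsConformalVector ω) (n : ℤ) (a b : V) :
    nprod 1 ω (nprod n a b) =
      nprod n (nprod 1 ω a) b + nprod n a (nprod 1 ω b) - (n + 1) • nprod n a b := by
  have hc := commutator 1 n ω a b
  -- Only `i = 0, 1` survive, since `C(1,i) = 0` for `i ≥ 2`. The term `i = 0` is `(L₋₁a)₍ₙ₊₁₎b =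
  -- -(n+1) a₍ₙ₎b`, the source of the shift.
  rw [finsum_eq_sum_of_support_subset (s := Finset.range 2)] at hc
  · rw [Finset.sum_range_succ, Finset.sum_range_one] at hc
    simp only [Nat.cast_zero, Nat.cast_one, Ring.choose_zero_right, Ring.choose_one_right,
      one_smul, sub_zero] at hc
    rw [h.nprod_zero, translation, show (1 + n - 1 : ℤ) = n by ring, sub_eq_iff_eq_add] at hc
    rw [hc, neg_smul, show (1 + n : ℤ) = n + 1 by ring]
    abel
  · intro i hi
    by_contra hi'
    have h2 : 1 < i := by simpa using hi'
    refine hi ?_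
    have : Ring.choose (1 : ℤ) i = 0 := by
      have := Ring.choose_natCast (R := ℤ) 1 i
      rw [Nat.choose_eq_zero_of_lt h2] at this
      simpa using this
    simp [this]

/-- Since `ω = L₋₂𝟙` and `L₀𝟙 = 0`, this is `[L₀, L₋₂] = 2L₋₂` applied to the vacuum; the central
term is absent because `0 + (-2) ≠ 0`. -/
lemma nprod_one_self (h : IsConformalVector ω) : nprod 1 ω ω = (2 : ℂ) • ω := by
  obtain ⟨c, hc⟩ := h.virasoro_relations
  have := LinearMap.congr_fun (hc 0 (-2)) vac
  simpa [virasoro, nprod_vac, nprod_vac_of_nonneg] using this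

lemma nprod_one_mem_C2 (h : IsConformalVector ω) {x : V} (hx : x ∈ C2 V) :
    nprod 1 ω x ∈ C2 V := by
  refine C2_induction (P := fun x => nprod 1 ω x ∈ C2 V) (fun a b => ?_) (by simp)
    (fun x y hx hy => by rw [map_add]; exact add_mem hx hy)
    (fun k x hx => by rw [map_smul]; exact (C2 V).smul_mem _ hx) hx
  rw [h.nprod_one_nprod]
  exact sub_mem (add_mem (nprod_mem_C2 le_rfl _ _) (nprod_mem_C2 le_rfl _ _))
    (zsmul_mem (nprod_mem_C2 le_rfl _ _) _)

/-- The operator on `R_V` induced by `L₀`. -/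
def weightOperator (h : IsConformalVector ω) : Module.End ℂ (ZhuC2 V) :=
  (C2 V).mapQ (C2 V) (nprod 1 ω) fun _ hx => h.nprod_one_mem_C2 hx

lemma weightOperator_mk (h : IsConformalVector ω) (a : V) :
    h.weightOperator (ZhuC2.mk a) = ZhuC2.mk (nprod 1 ω a) := rfl

/-- The defect `-(n+1) a₍ₙ₎b` vanishes at `n = -1`, the product that defines multiplication in
`R_V`. -/
lemma weightOperator_mul (h : IsConformalVector ω) (x y : ZhuC2 V) :
    h.weightOperator (x * y) = h.weightOperator x * y + x * h.weightOperator y := by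
  obtain ⟨a, rfl⟩ := ZhuC2.mk_surjective x
  obtain ⟨b, rfl⟩ := ZhuC2.mk_surjective y
  simp only [weightOperator_mk, ZhuC2.mk_mul_mk, ← map_add]
  rw [h.nprod_one_nprod]
  simp

lemma weightOperator_mk_pow (h : IsConformalVector ω) (n : ℕ) :
    h.weightOperator (ZhuC2.mk ω ^ n) = (2 * n : ℂ) • ZhuC2.mk ω ^ n := by
  induction n with
  | zero =>
    rw [pow_zero, ZhuC2.one_def, weightOperator_mk, nprod_vac_of_nonneg _ _ zero_le_one]
    simp
  | succ n ih =>
    rw [pow_succ, weightOperator_mul, ih, weightOperator_mk, h.nprod_one_self, map_smul,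
      smul_mul_assoc, mul_smul_comm, ← add_smul]
    congr 1
    push_cast
    ring

/-- The powers of `[ω]` have pairwise distinct weights. -/
lemma linearIndependent_pow (h : IsConformalVector ω)
    (hω : ¬ IsNilpotent (ZhuC2.mk ω)) : LinearIndependent ℂ fun n : ℕ => ZhuC2.mk ω ^ n := by
  refine Module.End.eigenvectors_linearIndependent' h.weightOperator (fun n : ℕ => (2 * n : ℂ))
    (fun m n hmn => ?_) _ fun n => ?_
  · simpa using hmn
  -- Non-nilpotency is what makes every power nonzero, hence a genuine eigenvector.
  · exact ⟨Module.End.mem_eigenspace_iff.2 (h.weightOperator_mk_pow n), fun h0 => hω ⟨n, h0⟩⟩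

/-- `[ω]` is a Casimir element of the Poisson algebra `R_V`. -/
lemma bracket_mk_right (h : IsConformalVector ω) (f : ZhuC2 V) :
    PoissonAlgebra.bracket f (ZhuC2.mk ω) = 0 := by
  obtain ⟨a, rfl⟩ := ZhuC2.mk_surjective f
  -- The bracket with `ω` on the left is a translate, hence zero in `R_V`; skew-symmetry modulo
  -- `C₂(V)` then moves `ω` to the right.
  have h1 : ZhuC2.mk (nprod 0 ω a) = 0 := by
    rw [h.nprod_zero, ZhuC2.mk_eq_zero]
    exact nprod_mem_C2 le_rfl _ _
  have h2 := ZhuC2.mk_eq_zero.2 (bracket_skew_mem_C2 a ω)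
  rwa [map_add, h1, add_zero] at h2

end IsConformalVector

end VertexAlgebra

/-! ### Casimir elements and symplectic leaves -/

namespace Specm

variable {R : Type*} [CommRing R] [Algebra ℂ R]

section Poisson

variable [PoissonAlgebra R]

/-- Along the curve `z` has derivative `{f, z} = 0`, so the mean value inequality with bound `0`
makes it constant. -/
lemma IsHamiltonianCurve.apply_eq {f z : R} {γ : ℝ → Specm R} (hγ : IsHamiltonianCurve f γ)
    (hz : PoissonAlgebra.bracket f z = 0) : γ 0 z = γ 1 z := by
  have hd : ∀ t ∈ Set.Icc (0 : ℝ) 1,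
      HasDerivWithinAt (fun s => γ s z) 0 (Set.Icc 0 1) t := fun t ht => by
    simpa [hz] using hγ t ht z
  have := (convex_Icc (0 : ℝ) 1).norm_image_sub_le_of_norm_hasDerivWithin_le (C := 0) hd
    (by simp) (Set.left_mem_Icc.2 zero_le_one) (Set.right_mem_Icc.2 zero_le_one)
  rw [zero_mul, norm_le_zero_iff, sub_eq_zero] at this
  exact this.symm

/-- Having equal `z`-values is an equivalence relation, so it is enough to treat a single
Hamiltonian curve. -/
lemma apply_eq_of_leafSetoid {z : R} (hz : ∀ f : R, PoissonAlgebra.bracket f z = 0)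
    {x y : Specm R} (h : leafSetoid R x y) : x z = y z := by
  change Relation.EqvGen HamiltonianJoined x y at h
  induction h with
  | rel x y h =>
    obtain ⟨k, f, γ, hγ, -, rfl, rfl⟩ := h
    exact hγ.apply_eq (hz f)
  | refl x => rfl
  | symm x y _ ih => exact ih.symm
  | trans x y w _ _ ih₁ ih₂ => exact ih₁.trans ih₂

/-- A Casimir element takes finitely many values if there are finitely many symplectic leaves. -/
lemma finite_range_apply [Finite (SymplecticLeaves R)] {z : R}
    (hz : ∀ f : R, PoissonAlgebra.bracket f z = 0) :
    (Set.range fun x : Specm R => x z).Finite := by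
  refine (Set.finite_range (Quotient.lift (s := leafSetoid R) (fun x : Specm R => x z)
    fun _ _ h => apply_eq_of_leafSetoid hz h)).subset ?_
  rintro _ ⟨x, rfl⟩
  exact ⟨Quotient.mk _ x, rfl⟩

end Poisson

/-! ### Nullstellensatz and integrality -/

/-- A function that vanishes at every closed point is nilpotent. -/
lemma isNilpotent_of_forall_apply_eq_zero [Algebra.FiniteType ℂ R] {f : R}
    (hf : ∀ x : Specm R, x f = 0) : IsNilpotent f := by
  have : IsJacobsonRing R := isJacobsonRing_of_finiteType (A := ℂ)
  -- Every maximal ideal is the kernel of a closed point, so `f` lies in all of them; in a Jacobson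
  -- ring their intersection is the nilradical.
  have hmem : f ∈ (nilradical R).jacobson := Ideal.mem_sInf.2 fun {J} hJ => by
    obtain ⟨x, hx⟩ := (ker_bijective R).2 ⟨J, hJ.2⟩
    have hxJ : RingHom.ker x = J := congrArg MaximalSpectrum.asIdeal hx
    rw [← hxJ, RingHom.mem_ker]
    exact hf x
  rwa [isJacobsonRing_iff.1 this (nilradical R) (Ideal.radical_isRadical _), mem_nilradical] at hmem

/-- A function with finitely many values is integral over `ℂ`. -/
lemma isIntegral_of_finite_range [Algebra.FiniteType ℂ R] {f : R}
    (hf : (Set.range fun x : Specm R => x f).Finite) :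
    IsIntegral ℂ f := by
  set q : Polynomial ℂ := ∏ c ∈ hf.toFinset, (Polynomial.X - Polynomial.C c) with hq
  have hqm : q.Monic := Polynomial.monic_prod_X_sub_C _ _
  obtain ⟨n, hn⟩ := isNilpotent_of_forall_apply_eq_zero (f := Polynomial.aeval f q) fun x => by
    rw [← Polynomial.aeval_algHom_apply, hq, map_prod]
    exact Finset.prod_eq_zero (hf.mem_toFinset.2 ⟨x, rfl⟩) (by simp)
  -- `R` need not be reduced, so `q(f)` is only nilpotent and a power of `q` is needed to annihilate
  -- `f`.
  exact ⟨q ^ n, hqm.pow n, by rw [← Polynomial.aeval_def, map_pow, hn]⟩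

end Specm

theorem mainTheorem5 {V : Type*} [AddCommGroup V] [Module ℂ V] [VertexAlgebra V] (ω : V)
    (hconical : VertexAlgebra.IsConical ω) (hquasilisse : VertexAlgebra.IsQuasiLisse V) :
    IsNilpotent (VertexAlgebra.ZhuC2.mk ω) := by
  by_contra hω
  have hconf := hconical.conformal
  have : Algebra.FiniteType ℂ (VertexAlgebra.ZhuC2 V) := hquasilisse.1
  have : Finite (Specm.SymplecticLeaves (VertexAlgebra.ZhuC2 V)) := hquasilisse.2
  obtain ⟨p, hp, hp0⟩ := Specm.isIntegral_of_finite_range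
    (Specm.finite_range_apply hconf.bracket_mk_right)
  rw [← Polynomial.aeval_def, Polynomial.aeval_eq_sum_range] at hp0
  -- Independence of the powers kills every coefficient of the monic relation, including the leading
  -- coefficient `1`.
  have h0 := linearIndependent_iff'.1 (hconf.linearIndependent_pow hω) _ _ hp0 p.natDegree
    (Finset.self_mem_range_succ _)
  exact one_ne_zero (hp.coeff_natDegree.symm.trans h0)
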